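/- Let $(X,\mathcal B,\mu)$ be a probability space and let $U:X\to X$ be an invertible measure-preserving transformation (with measurable inverse). For a real- or complex-valued measurable function $f$ on $X$ let $$\tilde M f(x)=\sup_{J\ge 1}\frac1{2J+1}\sum_{k=-J}^{J}|f(U^{-k}x)|\in[0,\infty]$$ be the maximal ergodic operator. Let $w:X\to\mathbb R$ be a non-negative integrable function. For $1\le p<\infty$ write $f\in L^p_w(X)$ if $f$ is measurable and $\int_X|f|^p\,w\,d\mu<\infty$, and put $\|f\|_{L^p_w(X)}=\left(\int_X|f|^p\,w\,d\mu\right)^{1/p}$; the same notation is used for $[0,\infty]$-valued functions. For $1<p<\infty$, $w$ is an ergodic $A_p$ weight with constant (at most) $K<\infty$ if $$\operatorname*{ess\,sup}_{x\in X}\ \sup_{N\ge1}\left(\frac1{2N+1}\sum_{k=-N}^{N}w(U^kx)\right)\left(\frac1{2N+1}\sum_{k=-N}^{N}w(U^kx)^{-\frac1{p-1}}\right)^{p-1}\le K,$$ where $0^{-1/(p-1)}=\infty$ and $0\cdot\infty=0$. It is an ergodic $A_1$ weight with constant (at most) $K<\infty$ if for almost every $x\in X$, all $N\ge1$ and all $m\in\{-N,\dots,N\}$,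 $$\frac1{2N+1}\sum_{k=-N}^{N}w(U^kx)\le K\,w(U^mx).$$ Then the following hold. (1) Let $1<p<\infty$ and let $w$ be an ergodic $A_p$ weight with constant $K$. There is a finite constant $C$, depending only on $p$ and $K$, such that for every $f\in L^p_w(X)$ one has $\tilde Mf\in L^p_w(X)$ and $$\|\tilde M f\|_{L^p_w(X)}\le C\,\|f\|_{L^p_w(X)}.$$ (2) Let $w$ be an ergodic $A_1$ weight with constant $K$. There is a finite constant $C$, depending only on $K$, such that for every $f\in L^1_w(X)$ the function $\tilde Mf$ is measurable (up to a null set) and, for every $\lambda>0$, $$\int_{\{x\in X:\ \tilde Mf(x)>\lambda\}}w\,d\mu\le\frac{C}{\lambda}\int_X|f|\,w\,d\mu .$$ -/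

import Mathlib

open MeasureTheory
open scoped ENNReal NNReal

noncomputable section

namespace ErgodicWeights

variable {X : Type*} [MeasurableSpace X]

/-- The two-sided ergodic average `(1 / (2N+1)) * ∑_{k=-N}^{N} g (U^k x)` of a function with
values in `[0, ∞]` along the orbit of `x` under the invertible transformation `U`. -/
def ergodicAverage (U : X ≃ᵐ X) (g : X → ℝ≥0∞) (N : ℕ) (x : X) : ℝ≥0∞ :=
  (∑ k ∈ Finset.Icc (-(N : ℤ)) (N : ℤ), g (((U.toEquiv : Equiv.Perm X) ^ k) x)) /
    (2 * (N : ℝ≥0∞) + 1)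

/-- The maximal ergodic operator
`sup_{J ≥ 1} (1 / (2J+1)) * ∑_{k=-J}^{J} |f (U^(-k) x)|`, with values in `[0, ∞]`. -/
def maximalErgodic {ε : Type*} [ENorm ε] (U : X ≃ᵐ X) (f : X → ε) (x : X) : ℝ≥0∞ :=
  ⨆ (J : ℕ) (_ : 1 ≤ J),
    (∑ k ∈ Finset.Icc (-(J : ℤ)) (J : ℤ), ‖f (((U.toEquiv : Equiv.Perm X) ^ (-k)) x)‖ₑ) /
      (2 * (J : ℝ≥0∞) + 1)

/-- `w` is an ergodic `A_p` weight (`1 < p < ∞`) with `A_p` constant at most `K`.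
The powers are computed in `[0, ∞]`, so `0 ^ (-1/(p-1)) = ∞`, and `0 * ∞ = 0`. -/
structure IsErgodicApWeight (U : X ≃ᵐ X) (μ : Measure X) (p : ℝ) (w : X → ℝ) (K : ℝ≥0) :
    Prop where
  nonneg : ∀ x, 0 ≤ w x
  integrable : Integrable w μ
  essSup_le :
    essSup (fun x => ⨆ (N : ℕ) (_ : 1 ≤ N),
      ergodicAverage U (fun y => ENNReal.ofReal (w y)) N x *
        ergodicAverage U (fun y => ENNReal.ofReal (w y) ^ (-1 / (p - 1))) N x ^ (p - 1)) μ
      ≤ (K : ℝ≥0∞)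

/-- `w` is an ergodic `A_1` weight with `A_1` constant at most `K`. -/
structure IsErgodicA1Weight (U : X ≃ᵐ X) (μ : Measure X) (w : X → ℝ) (K : ℝ≥0) :
    Prop where
  nonneg : ∀ x, 0 ≤ w x
  integrable : Integrable w μ
  average_le :
    ∀ᵐ x ∂μ, ∀ N : ℕ, 1 ≤ N → ∀ m : ℤ, -(N : ℤ) ≤ m → m ≤ (N : ℤ) →
      ergodicAverage U (fun y => ENNReal.ofReal (w y)) N x ≤
        (K : ℝ≥0∞) * ENNReal.ofReal (w (((U.toEquiv : Equiv.Perm X) ^ m) x))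

/-- The norm `(∫ |f|^p w dμ)^(1/p)` of `L^p_w(X)`, with values in `[0, ∞]`. -/
def weightedLpNorm {ε : Type*} [ENorm ε] (μ : Measure X) (p : ℝ) (w : X → ℝ) (f : X → ε) :
    ℝ≥0∞ :=
  (∫⁻ x, ‖f x‖ₑ ^ p * ENNReal.ofReal (w x) ∂μ) ^ (1 / p)

/-- `f` belongs to `L^p_w(X)`: `f` is measurable (up to a null set) and `∫ |f|^p w dμ < ∞`. -/
def MemWeightedLp {ε : Type*} [ENorm ε] [MeasurableSpace ε] (μ : Measure X) (p : ℝ)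
    (w : X → ℝ) (f : X → ε) : Prop :=
  AEMeasurable f μ ∧ ∫⁻ x, ‖f x‖ₑ ^ p * ENNReal.ofReal (w x) ∂μ < ∞

end ErgodicWeights

end

/-!
# Weighted bounds for the maximal ergodic operator

The argument carries Lerner's proof of Muckenhoupt's theorem over to the orbits of `U`. Its point
is that the maximal operator of *any* weight on the orbits, doubling or not, is bounded on the
spaces of that same weight. For `v : X → [0, ∞]` let
`M_v g (x) = sup_{a ≤ 0 ≤ b} (∑_{a ≤ k ≤ b} (g v)(U^k x)) / (∑_{a ≤ k ≤ b} v(U^k x))`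
(`ratioMaximal`).

A greedy covering of a long stretch of the orbit (`mul_sum_indicator_le_sum`), integrated over `X`,
gives Hopf's ratio maximal inequality for forward sums (`mul_setLIntegral_le`). It is applied to
`U` and `U⁻¹`, and yields the weak type `(1, 1)` of `M_v` with respect to `v dμ`
(`mul_setLIntegral_ratioMaximal_le`); truncation at half the level and the layer-cake formula then
give the strong type `(q, q)` for `q > 1` (`lintegral_ratioMaximal_rpow_le`). The constants do not
depend on `v`, which need not be integrable.

For an `A_p` weight `w` put `σ = w^(-1/(p-1))`, and let `Q` be a centred window of `n` points of the
orbit of `x`. Since `(∑_Q f) / σ(Q) ≤ M_σ (f/σ)` at every point of `Q`, the `A_p` condition implies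
`((∑_Q f) / n)^(p-1) ≤ K (n / w(Q)) ((∑_Q f) / σ(Q))^(p-1) ≤ K M_w (M_σ (f/σ)^(p-1) / w) (x)`
(`average_rpow_le_ratioMaximal`). The strong type of `M_w` with exponent `p' = p/(p-1)`, the
identity `w^(1-p') = σ`, and the strong type of `M_σ` with exponent `p` bound the maximal operator
on `L^p_w` (`lintegral_maximalErgodic_rpow_le`).

For an `A_1` weight the maximal function of `f` is at most `K M_w f` wherever `w` is positive
(`maximalErgodic_le_ratioMaximal`), so the weak type of `M_w` is all that is needed.

Everything is done with `[0, ∞]`-valued functions, so no integrability has to be tracked. A point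
where `w` vanishes contributes nothing to the weighted integrals, whatever the junk values there.
-/

open MeasureTheory
open scoped ENNReal NNReal

namespace ErgodicWeights

/-! ### Hopf's maximal inequality for forward sums -/

/-- Covering lemma on `ℕ`: call `j` bad if some block of at most `N` terms starting at `j` satisfies
`c * ∑ a < ∑ b`. The bad indices of a stretch are covered greedily by disjoint bad blocks, which
overrun the stretch by at most `N` terms. -/
theorem mul_sum_indicator_le_sum (a b : ℕ → ℝ≥0∞) (c : ℝ≥0∞) (N L s : ℕ) :
    c * ∑ k ∈ Finset.range L, {j | ∃ n ≤ N, c * ∑ i ∈ Finset.range n, a (j + i) <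
        ∑ i ∈ Finset.range n, b (j + i)}.indicator a (s + k) ≤
      ∑ k ∈ Finset.range (L + N), b (s + k) := by
  set E : Set ℕ := {j | ∃ n ≤ N, c * ∑ i ∈ Finset.range n, a (j + i) <
        ∑ i ∈ Finset.range n, b (j + i)} with hE
  induction L using Nat.strong_induction_on generalizing s with
  | _ L ih =>
    rcases Nat.eq_zero_or_pos L with rfl | hL
    · simp
    -- A bad first index starts a block to remove; a good one is removed alone.
    by_cases hs : s ∈ E
    · obtain ⟨n, hnN, hn⟩ := hs
      have hn0 : n ≠ 0 := by
        rintro rfl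
        simp at hn
      have hfirst : c * ∑ k ∈ Finset.range n, E.indicator a (s + k) ≤
          ∑ k ∈ Finset.range n, b (s + k) := by
        refine le_trans ?_ hn.le
        gcongr
        exact Set.indicator_le_self _ _ _
      rcases le_or_gt L n with h | h
      · refine le_trans ?_ (hfirst.trans ?_)
        · gcongr
        · exact Finset.sum_le_sum_of_subset (Finset.range_mono (by omega))
      · obtain ⟨m, rfl⟩ := Nat.exists_eq_add_of_lt h
        have := ih (m + 1) (by omega) (s + n)
        rw [show n + m + 1 = n + (m + 1) by ring, Finset.sum_range_add _ n (m + 1), mul_add,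
          add_assoc n, Finset.sum_range_add _ n (m + 1 + N)]
        simp only [← add_assoc] at this hfirst ⊢
        exact add_le_add hfirst this
    · obtain ⟨m, rfl⟩ := Nat.exists_eq_add_of_lt hL
      have := ih m (by omega) (s + 1)
      rw [show 0 + m + 1 = m + 1 by ring, show m + 1 + N = (m + N) + 1 by ring,
        Finset.sum_range_succ', Finset.sum_range_succ']
      simp only [add_zero, Set.indicator_of_notMem hs]
      refine le_trans (le_of_eq_of_le ?_ this) (le_trans (le_of_eq ?_) le_self_add)
      · congr 2 with k; congr 1; ring
      · congr 1 with k; congr 1; ring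

theorem le_of_forall_natCast_mul_le {a b : ℝ≥0∞} (N : ℕ)
    (h : ∀ L : ℕ, (L : ℝ≥0∞) * a ≤ ((L + N : ℕ) : ℝ≥0∞) * b) : a ≤ b := by
  rcases eq_or_ne b ⊤ with rfl | hb
  · exact le_top
  have ha : a ≠ ⊤ := by
    rintro rfl
    have := h 1
    simp only [Nat.cast_one, one_mul, top_le_iff] at this
    exact ENNReal.mul_ne_top (ENNReal.natCast_ne_top _) hb this
  lift a to ℝ≥0 using ha
  lift b to ℝ≥0 using hb
  have h' : ∀ L : ℕ, (L : ℝ) * a ≤ (L + N) * b := fun L => by exact_mod_cast h L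
  by_contra! hlt
  have hlt' : (b : ℝ) < a := by exact_mod_cast hlt
  obtain ⟨L, hL⟩ := exists_nat_gt (N * b / (a - b) : ℝ)
  rw [div_lt_iff₀ (by linarith)] at hL
  nlinarith [h' L]

section Forward

variable {X : Type*} [MeasurableSpace X] {μ : Measure X} {T : X → X}

/-- The covering lemma on the orbit of `x`, integrated over `X`: a stretch of length `L` gives
`L * (c * ∫_E v) ≤ (L + N) * ∫ h`, and the overrun `N` is negligible as `L → ∞`. -/
theorem mul_setLIntegral_le_of_le (hT : MeasurePreserving T μ μ) {v h : X → ℝ≥0∞}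
    (hv : Measurable v) (hh : Measurable h) (c : ℝ≥0∞) (N : ℕ) :
    c * ∫⁻ x in {x | ∃ n ≤ N, c * ∑ i ∈ Finset.range n, v (T^[i] x) <
        ∑ i ∈ Finset.range n, h (T^[i] x)}, v x ∂μ ≤ ∫⁻ x, h x ∂μ := by
  set E : Set X := {x | ∃ n ≤ N, c * ∑ i ∈ Finset.range n, v (T^[i] x) <
        ∑ i ∈ Finset.range n, h (T^[i] x)} with hE
  have hiter : ∀ i, Measurable (T^[i]) := fun i => (hT.iterate i).measurable
  have hEm : MeasurableSet E := by
    have : E = ⋃ n, ⋃ (_ : n ≤ N), {x | c * ∑ i ∈ Finset.range n, v (T^[i] x) <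
        ∑ i ∈ Finset.range n, h (T^[i] x)} := by
      ext x; simp [hE]
    rw [this]
    refine MeasurableSet.iUnion fun n => MeasurableSet.iUnion fun _ => measurableSet_lt ?_ ?_
    · exact (Finset.measurable_fun_sum _ fun i _ => hv.comp (hiter i)).const_mul c
    · exact Finset.measurable_fun_sum _ fun i _ => hh.comp (hiter i)
  rw [← lintegral_indicator hEm]
  refine le_of_forall_natCast_mul_le N fun L => ?_
  have hint : ∀ {φ : X → ℝ≥0∞}, Measurable φ → ∀ n : ℕ,
      ∫⁻ x, ∑ k ∈ Finset.range n, φ (T^[k] x) ∂μ = n * ∫⁻ x, φ x ∂μ := by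
    intro φ hφ n
    refine (lintegral_finsetSum _ fun i _ => hφ.comp (hiter i)).trans ?_
    simp [fun i => (hT.iterate i).lintegral_comp hφ]
  rw [← hint hh, mul_left_comm, ← hint (hv.indicator hEm), ← lintegral_const_mul]
  · refine lintegral_mono fun x => ?_
    have := mul_sum_indicator_le_sum (fun k => v (T^[k] x)) (fun k => h (T^[k] x)) c N L 0
    simp only [zero_add] at this
    refine le_of_eq_of_le ?_ this
    congr 2 with k
    simp only [Set.indicator_apply, hE, Set.mem_ofPred_eq, ← Function.iterate_add_apply,
      add_comm]
  · exact Finset.measurable_fun_sum _ fun i _ => (hv.indicator hEm).comp (hiter i)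

/-- **Hopf's maximal inequality** in ratio form, for `[0, ∞]`-valued functions without any
integrability assumption. -/
theorem mul_setLIntegral_le (hT : MeasurePreserving T μ μ) {v h : X → ℝ≥0∞}
    (hv : Measurable v) (hh : Measurable h) (c : ℝ≥0∞) :
    c * ∫⁻ x in {x | ∃ n, c * ∑ i ∈ Finset.range n, v (T^[i] x) <
        ∑ i ∈ Finset.range n, h (T^[i] x)}, v x ∂μ ≤ ∫⁻ x, h x ∂μ := by
  have : {x | ∃ n, c * ∑ i ∈ Finset.range n, v (T^[i] x) <
        ∑ i ∈ Finset.range n, h (T^[i] x)} =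
      ⋃ N : ℕ, {x | ∃ n ≤ N, c * ∑ i ∈ Finset.range n, v (T^[i] x) <
        ∑ i ∈ Finset.range n, h (T^[i] x)} := by
    ext x
    simp only [Set.mem_ofPred_eq, Set.mem_iUnion]
    exact ⟨fun ⟨n, hn⟩ => ⟨n, n, le_rfl, hn⟩, fun ⟨_, n, _, hn⟩ => ⟨n, hn⟩⟩
  rw [this, setLIntegral_iUnion_of_directed, ENNReal.mul_iSup]
  · exact iSup_le fun N => mul_setLIntegral_le_of_le hT hv hh c N
  · refine Monotone.directed_le fun M N hMN x => ?_
    rintro ⟨n, hn, hlt⟩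
    exact ⟨n, hn.trans hMN, hlt⟩

end Forward

/-! ### From weak type to strong type -/

/-- The layer-cake formula `t ^ r = r * ∫_0^t s ^ (r - 1) ds`, including `t = ∞`. -/
theorem rpow_eq_lintegral {r : ℝ} (hr : 0 < r) (t : ℝ≥0∞) :
    t ^ r = ENNReal.ofReal r *
      ∫⁻ s in Set.Ioi (0 : ℝ), {s : ℝ | ENNReal.ofReal s < t}.indicator
        (fun s => ENNReal.ofReal (s ^ (r - 1))) s := by
  have key : ∀ b : ℝ≥0, (b : ℝ≥0∞) ^ r = ENNReal.ofReal r *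
      ∫⁻ s in Set.Ioi (0 : ℝ), {s : ℝ | ENNReal.ofReal s < b}.indicator
        (fun s => ENNReal.ofReal (s ^ (r - 1))) s := by
    intro b
    have hm : MeasurableSet {s : ℝ | ENNReal.ofReal s < b} :=
      measurableSet_lt ENNReal.measurable_ofReal measurable_const
    have hset : Set.Ioi (0 : ℝ) ∩ {s : ℝ | ENNReal.ofReal s < b} = Set.Ioo 0 (b : ℝ) := by
      ext s
      simp only [Set.mem_inter_iff, Set.mem_Ioi, Set.mem_ofPred_eq, Set.mem_Ioo]
      refine and_congr_right fun hs => ?_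
      rw [← ENNReal.ofReal_coe_nnreal, ENNReal.ofReal_lt_ofReal_iff_of_nonneg hs.le]
    rw [setLIntegral_indicator hm, Set.inter_comm, hset]
    have hi : IntegrableOn (fun s : ℝ => s ^ (r - 1)) (Set.Ioo 0 (b : ℝ)) := by
      have := (intervalIntegral.intervalIntegrable_rpow' (a := 0) (b := b)
        (show -1 < r - 1 by linarith))
      rw [intervalIntegrable_iff_integrableOn_Ioo_of_le b.coe_nonneg] at this
      exact this
    rw [← ofReal_integral_eq_lintegral_ofReal hi, ← integral_Ioc_eq_integral_Ioo,
      ← intervalIntegral.integral_of_le b.coe_nonneg, integral_rpow (Or.inl (by linarith)),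
      ← ENNReal.ofReal_mul hr.le, sub_add_cancel, Real.zero_rpow hr.ne', sub_zero,
      mul_div_cancel₀ _ hr.ne', ← ENNReal.ofReal_coe_nnreal,
      ENNReal.ofReal_rpow_of_nonneg b.coe_nonneg hr.le]
    exact (ae_restrict_mem measurableSet_Ioo).mono fun s hs => Real.rpow_nonneg hs.1.le _
  rcases eq_or_ne t ⊤ with rfl | ht
  · rw [ENNReal.top_rpow_of_pos hr]
    refine (ENNReal.eq_top_of_forall_nnreal_le fun b => ?_).symm
    calc (b : ℝ≥0∞) = ((b ^ (r⁻¹) : ℝ≥0) : ℝ≥0∞) ^ r := by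
          rw [ENNReal.coe_rpow_of_nonneg _ (by positivity), ← ENNReal.rpow_mul,
            inv_mul_cancel₀ hr.ne', ENNReal.rpow_one]
      _ ≤ _ := by
          rw [key]
          gcongr
          exact le_top
  · lift t to ℝ≥0 using ht
    exact key t

/-- The constant `8 q 2^(q-1) / (q-1)` of the strong type `(q, q)` inequality of
`lintegral_rpow_mul_le`. -/
noncomputable def strongConst (q : ℝ) : ℝ≥0∞ :=
  ENNReal.ofReal q * (8 * (ENNReal.ofReal (q - 1))⁻¹ * 2 ^ (q - 1))

theorem strongConst_ne_top {q : ℝ} (hq : 1 < q) : strongConst q ≠ ⊤ := by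
  have hq1 : 0 < q - 1 := by linarith
  refine ENNReal.mul_ne_top ENNReal.ofReal_ne_top (ENNReal.mul_ne_top (ENNReal.mul_ne_top
    (by simp) ?_) (ENNReal.rpow_ne_top_of_nonneg hq1.le (by simp)))
  simpa using hq

/-- Marcinkiewicz interpolation with `L^∞`, in weighted form: a weak type inequality in which only
the part of `g` above half the level enters implies the strong type `(q, q)` for `q > 1`. -/
theorem lintegral_rpow_mul_le {X : Type*} [MeasurableSpace X] {μ : Measure X} [SFinite μ]
    {q : ℝ} (hq : 1 < q) {G g v : X → ℝ≥0∞} (hG : Measurable G) (hg : Measurable g)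
    (hv : Measurable v)
    (h : ∀ c : ℝ≥0∞, c * ∫⁻ x in {x | c < G x}, v x ∂μ ≤
      8 * ∫⁻ x in {x | c / 2 < g x}, g x * v x ∂μ) :
    ∫⁻ x, G x ^ q * v x ∂μ ≤ strongConst q * ∫⁻ x, g x ^ q * v x ∂μ := by
  have hq0 : 0 < q := by linarith
  have hq1 : 0 < q - 1 := by linarith
  -- Tonelli's theorem for the layer-cake representation of `φ ^ r`.
  have cake : ∀ {r : ℝ}, 0 < r → ∀ {φ u : X → ℝ≥0∞}, Measurable φ → Measurable u →
      ∫⁻ x, φ x ^ r * u x ∂μ = ENNReal.ofReal r * ∫⁻ s in Set.Ioi (0 : ℝ),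
        ENNReal.ofReal (s ^ (r - 1)) * ∫⁻ x in {x | ENNReal.ofReal s < φ x}, u x ∂μ := by
    intro r hr φ u hφ hu
    have hmeas : Measurable (fun z : X × ℝ =>
        {s : ℝ | ENNReal.ofReal s < φ z.1}.indicator
          (fun s => ENNReal.ofReal (s ^ (r - 1))) z.2) := by
      have : MeasurableSet {z : X × ℝ | ENNReal.ofReal z.2 < φ z.1} :=
        measurableSet_lt (ENNReal.measurable_ofReal.comp measurable_snd)
          (hφ.comp measurable_fst)
      exact Measurable.indicator (f := fun z : X × ℝ => ENNReal.ofReal (z.2 ^ (r - 1)))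
        (by fun_prop) this
    calc ∫⁻ x, φ x ^ r * u x ∂μ
        = ∫⁻ x, ENNReal.ofReal r * (∫⁻ s in Set.Ioi (0 : ℝ),
            {s : ℝ | ENNReal.ofReal s < φ x}.indicator
              (fun s => ENNReal.ofReal (s ^ (r - 1))) s * u x) ∂μ := by
          refine lintegral_congr fun x => ?_
          have hx : Measurable ({s : ℝ | ENNReal.ofReal s < φ x}.indicator
              (fun s => ENNReal.ofReal (s ^ (r - 1)))) := hmeas.comp measurable_prodMk_left
          rw [rpow_eq_lintegral hr, lintegral_mul_const _ hx, mul_assoc]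
      _ = ENNReal.ofReal r * ∫⁻ s in Set.Ioi (0 : ℝ), ∫⁻ x,
            ({s : ℝ | ENNReal.ofReal s < φ x}.indicator
              (fun s => ENNReal.ofReal (s ^ (r - 1))) s * u x) ∂μ := by
          have hm2 : Measurable (Function.uncurry fun (x : X) (s : ℝ) =>
              {s : ℝ | ENNReal.ofReal s < φ x}.indicator
                (fun s => ENNReal.ofReal (s ^ (r - 1))) s * u x) :=
            hmeas.mul (hu.comp measurable_fst)
          rw [lintegral_const_mul _ (Measurable.lintegral_prod_right hm2),
            lintegral_lintegral_swap hm2.aemeasurable]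
      _ = _ := by
          congr 1
          refine lintegral_congr fun s => ?_
          rw [← lintegral_indicator (measurableSet_lt measurable_const hφ),
            ← lintegral_const_mul _ (hu.indicator (measurableSet_lt measurable_const hφ))]
          refine lintegral_congr fun x => ?_
          by_cases hx : ENNReal.ofReal s < φ x <;> simp [hx]
  rw [cake hq0 hG hv]
  have h2 : ∫⁻ s in Set.Ioi (0 : ℝ),
        ENNReal.ofReal (s ^ (q - 1)) * ∫⁻ x in {x | ENNReal.ofReal s < G x}, v x ∂μ ≤
      8 * ∫⁻ s in Set.Ioi (0 : ℝ), ENNReal.ofReal (s ^ (q - 1 - 1)) *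
        ∫⁻ x in {x | ENNReal.ofReal s < 2 * g x}, g x * v x ∂μ := by
    rw [← lintegral_const_mul' _ _ (by simp)]
    refine setLIntegral_mono' measurableSet_Ioi fun s (hs : 0 < s) => ?_
    have hset : {x | ENNReal.ofReal s < 2 * g x} = {x | ENNReal.ofReal s / 2 < g x} := by
      ext x
      simp only [Set.mem_ofPred_eq]
      rw [ENNReal.div_lt_iff (by simp) (by simp), mul_comm]
    rw [hset, show s ^ (q - 1) = s ^ (q - 1 - 1) * s by
      rw [← Real.rpow_add_one hs.ne', sub_add_cancel],
      ENNReal.ofReal_mul (Real.rpow_nonneg hs.le _), mul_assoc, mul_left_comm 8]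
    exact mul_le_mul_right (h _) _
  have h3 := cake hq1 (hg.const_mul 2) (hg.mul hv)
  have h4 : ∫⁻ x, (2 * g x) ^ (q - 1) * (g x * v x) ∂μ =
      2 ^ (q - 1) * ∫⁻ x, g x ^ q * v x ∂μ := by
    rw [← lintegral_const_mul _ (by fun_prop)]
    refine lintegral_congr fun x => ?_
    rw [ENNReal.mul_rpow_of_nonneg _ _ hq1.le, mul_assoc, ← mul_assoc (g x ^ (q - 1))]
    congr 2
    nth_rw 2 [← ENNReal.rpow_one (g x)]
    rw [← ENNReal.rpow_add_of_nonneg _ _ hq1.le zero_le_one, sub_add_cancel]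
  simp only [Pi.mul_apply] at h3
  rw [h4] at h3
  calc _ ≤ ENNReal.ofReal q * (8 * ∫⁻ s in Set.Ioi (0 : ℝ), ENNReal.ofReal (s ^ (q - 1 - 1)) *
        ∫⁻ x in {x | ENNReal.ofReal s < 2 * g x}, g x * v x ∂μ) := by gcongr
    _ = ENNReal.ofReal q * (8 * (ENNReal.ofReal (q - 1))⁻¹ * (ENNReal.ofReal (q - 1) *
        ∫⁻ s in Set.Ioi (0 : ℝ), ENNReal.ofReal (s ^ (q - 1 - 1)) *
        ∫⁻ x in {x | ENNReal.ofReal s < 2 * g x}, g x * v x ∂μ)) := by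
      rw [mul_assoc 8, ← mul_assoc _⁻¹,
        ENNReal.inv_mul_cancel (by simpa using hq1) ENNReal.ofReal_ne_top, one_mul]
    _ = _ := by
      rw [← h3, strongConst]
      ring

/-! ### The maximal operator of a weight along orbits -/

section Ratio

variable {X : Type*} [MeasurableSpace X]

theorem measurePreserving_zpow {μ : Measure X} {U : X ≃ᵐ X} (hU : MeasurePreserving U μ μ)
    (k : ℤ) : MeasurePreserving ((U.toEquiv : Equiv.Perm X) ^ k : Equiv.Perm X) μ μ := by
  cases k with
  | ofNat n => exact hU.iterate n
  | negSucc n =>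
    rw [zpow_negSucc, ← inv_pow]
    exact (hU.symm U).iterate (n + 1)

theorem measurable_zpow (U : X ≃ᵐ X) (k : ℤ) :
    Measurable ((U.toEquiv : Equiv.Perm X) ^ k : Equiv.Perm X) := by
  cases k with
  | ofNat n => exact U.measurable.iterate n
  | negSucc n =>
    rw [zpow_negSucc, ← inv_pow]
    exact U.symm.measurable.iterate (n + 1)

/-- The sum of `φ (U ^ k x)` over the integers `a ≤ k ≤ b`. -/
noncomputable def orbitSum (U : X ≃ᵐ X) (φ : X → ℝ≥0∞) (a b : ℤ) (x : X) : ℝ≥0∞ :=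
  ∑ k ∈ Finset.Icc a b, φ (((U.toEquiv : Equiv.Perm X) ^ k) x)

theorem measurable_orbitSum (U : X ≃ᵐ X) {φ : X → ℝ≥0∞} (hφ : Measurable φ) (a b : ℤ) :
    Measurable (orbitSum U φ a b) :=
  Finset.measurable_fun_sum _ fun k _ => hφ.comp (measurable_zpow U k)

theorem orbitSum_shift (U : X ≃ᵐ X) (φ : X → ℝ≥0∞) (a b m : ℤ) (x : X) :
    orbitSum U φ (a - m) (b - m) (((U.toEquiv : Equiv.Perm X) ^ m) x) = orbitSum U φ a b x := by
  unfold orbitSum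
  refine Finset.sum_nbij' (· + m) (· - m) ?_ ?_ ?_ ?_ ?_
  · intro k hk; simp only [Finset.mem_Icc] at hk ⊢; omega
  · intro k hk; simp only [Finset.mem_Icc] at hk ⊢; omega
  · intro k _; simp
  · intro k _; simp
  · intro k _; rw [zpow_add, Equiv.Perm.mul_apply]

theorem orbitSum_mono (U : X ≃ᵐ X) (φ : X → ℝ≥0∞) {a b a' b' : ℤ} (ha : a' ≤ a) (hb : b ≤ b')
    (x : X) : orbitSum U φ a b x ≤ orbitSum U φ a' b' x :=
  Finset.sum_le_sum_of_subset (Finset.Icc_subset_Icc ha hb)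

theorem orbitSum_le_add (U : X ≃ᵐ X) (φ : X → ℝ≥0∞) {a b : ℤ} (x : X) :
    orbitSum U φ a b x ≤ orbitSum U φ a 0 x + orbitSum U φ 0 b x := by
  unfold orbitSum
  rw [← Finset.sum_union_inter]
  refine le_trans (Finset.sum_le_sum_of_subset ?_) le_self_add
  intro k hk
  simp only [Finset.mem_union, Finset.mem_Icc] at hk ⊢
  omega

theorem orbitSum_zero_natCast (U : X ≃ᵐ X) (φ : X → ℝ≥0∞) (n : ℕ) (x : X) :
    orbitSum U φ 0 n x = ∑ i ∈ Finset.range (n + 1), φ (U^[i] x) := by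
  unfold orbitSum
  refine (Finset.sum_nbij' (fun i : ℕ => (i : ℤ)) Int.toNat ?_ ?_ ?_ ?_ ?_).symm
  · intro k hk; simp only [Finset.mem_Icc, Finset.mem_range] at hk ⊢; omega
  · intro k hk; simp only [Finset.mem_Icc, Finset.mem_range] at hk ⊢; omega
  · intro k _; simp
  · intro k hk; simp only [Finset.mem_Icc] at hk; simp [hk.1]
  · intro k _; rfl

theorem orbitSum_neg (U : X ≃ᵐ X) (φ : X → ℝ≥0∞) (a b : ℤ) (x : X) :
    orbitSum U.symm φ (-b) (-a) x = orbitSum U φ a b x := by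
  unfold orbitSum
  refine Finset.sum_nbij' (- ·) (- ·) ?_ ?_ ?_ ?_ ?_
  · intro k hk; simp only [Finset.mem_Icc] at hk ⊢; omega
  · intro k hk; simp only [Finset.mem_Icc] at hk ⊢; omega
  · intro k _; simp
  · intro k _; simp
  · intro k _
    rw [show (U.symm.toEquiv : Equiv.Perm X) = (U.toEquiv : Equiv.Perm X)⁻¹ from rfl,
      inv_zpow, zpow_neg]

/-- The two-sided maximal operator of the orbit measure with density `v`: the supremum, over the
integer intervals `[a, b]` containing `0`, of the `v`-weighted averages of `g` along the orbit. -/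
noncomputable def ratioMaximal (U : X ≃ᵐ X) (v g : X → ℝ≥0∞) (x : X) : ℝ≥0∞ :=
  ⨆ (a : ℤ) (b : ℤ) (_ : a ≤ 0) (_ : 0 ≤ b),
    orbitSum U (fun y => g y * v y) a b x / orbitSum U v a b x

theorem measurable_ratioMaximal (U : X ≃ᵐ X) {v g : X → ℝ≥0∞} (hv : Measurable v)
    (hg : Measurable g) : Measurable (ratioMaximal U v g) :=
  Measurable.iSup fun _ => Measurable.iSup fun _ => Measurable.iSup fun _ =>
    Measurable.iSup fun _ =>
      (measurable_orbitSum U (hg.mul hv) _ _).div (measurable_orbitSum U hv _ _)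

theorem orbitSum_div_le_ratioMaximal (U : X ≃ᵐ X) (v g : X → ℝ≥0∞) {a b m : ℤ} (ha : a ≤ m)
    (hb : m ≤ b) (x : X) :
    orbitSum U (fun y => g y * v y) a b x / orbitSum U v a b x ≤
      ratioMaximal U v g (((U.toEquiv : Equiv.Perm X) ^ m) x) := by
  rw [← orbitSum_shift U _ a b m, ← orbitSum_shift U v a b m]
  exact le_iSup_of_le (a - m) (le_iSup_of_le (b - m)
    (le_iSup_of_le (by omega) (le_iSup_of_le (by omega) le_rfl)))

/-- Weak type `(1, 1)` of `ratioMaximal U v` with respect to `v dμ`, for an arbitrary weight `v`. If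
the average over `[a, b] ∋ 0` exceeds `c`, then the average over `[0, b]` or over `[a, 0]` exceeds
`c / 2`. -/
theorem mul_setLIntegral_ratioMaximal_le {μ : Measure X} {U : X ≃ᵐ X}
    (hU : MeasurePreserving U μ μ) {v g : X → ℝ≥0∞} (hv : Measurable v) (hg : Measurable g)
    (c : ℝ≥0∞) :
    c * ∫⁻ x in {x | c < ratioMaximal U v g x}, v x ∂μ ≤ 4 * ∫⁻ x, g x * v x ∂μ := by
  set E : X ≃ᵐ X → Set X := fun T => {x | ∃ n, c / 2 * ∑ i ∈ Finset.range n, v (T^[i] x) <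
        ∑ i ∈ Finset.range n, g (T^[i] x) * v (T^[i] x)} with hE
  have hsub : {x | c < ratioMaximal U v g x} ⊆ E U ∪ E U.symm := by
    intro x hx
    simp only [Set.mem_ofPred_eq, ratioMaximal, lt_iSup_iff] at hx
    obtain ⟨a, b, ha, hb, hlt⟩ := hx
    replace hlt := ENNReal.mul_lt_of_lt_div hlt
    have hout : ∀ T : X ≃ᵐ X, x ∉ E T → ∀ n : ℕ,
        orbitSum T (fun y => g y * v y) 0 n x ≤ c / 2 * orbitSum T v 0 n x := by
      intro T hT n
      simp only [hE, Set.mem_ofPred_eq, not_exists, not_lt] at hT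
      rw [orbitSum_zero_natCast, orbitSum_zero_natCast]
      exact hT (n + 1)
    by_contra hx
    rw [Set.mem_union, not_or] at hx
    have h1 := hout U hx.1 b.toNat
    have h2 := hout U.symm hx.2 (-a).toNat
    rw [Int.toNat_of_nonneg hb] at h1
    rw [Int.toNat_of_nonneg (by omega), ← neg_zero, orbitSum_neg, orbitSum_neg] at h2
    refine absurd hlt (not_lt.2 ?_)
    calc orbitSum U (fun y => g y * v y) a b x
        ≤ orbitSum U (fun y => g y * v y) a 0 x + orbitSum U (fun y => g y * v y) 0 b x :=
          orbitSum_le_add U _ x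
      _ ≤ c / 2 * orbitSum U v a 0 x + c / 2 * orbitSum U v 0 b x := add_le_add h2 h1
      _ ≤ c / 2 * orbitSum U v a b x + c / 2 * orbitSum U v a b x := by
          gcongr
          · exact orbitSum_mono U v le_rfl hb x
          · exact orbitSum_mono U v ha le_rfl x
      _ = c * orbitSum U v a b x := by rw [← add_mul, ENNReal.add_halves]
  have hW1 : c / 2 * ∫⁻ x in E U, v x ∂μ ≤ ∫⁻ x, g x * v x ∂μ :=
    mul_setLIntegral_le hU hv (hg.mul hv) (c / 2)
  have hW2 : c / 2 * ∫⁻ x in E U.symm, v x ∂μ ≤ ∫⁻ x, g x * v x ∂μ :=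
    mul_setLIntegral_le (hU.symm U) hv (hg.mul hv) (c / 2)
  calc c * ∫⁻ x in {x | c < ratioMaximal U v g x}, v x ∂μ
      ≤ c * (∫⁻ x in E U, v x ∂μ + ∫⁻ x in E U.symm, v x ∂μ) := by
        gcongr
        exact (lintegral_mono_set hsub).trans (lintegral_union_le _ _ _)
    _ = 2 * (c / 2 * ∫⁻ x in E U, v x ∂μ + c / 2 * ∫⁻ x in E U.symm, v x ∂μ) := by
        rw [← mul_add, ← mul_assoc, ENNReal.mul_div_cancel two_ne_zero ENNReal.ofNat_ne_top]
    _ ≤ 2 * (∫⁻ x, g x * v x ∂μ + ∫⁻ x, g x * v x ∂μ) := by gcongr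
    _ = 4 * ∫⁻ x, g x * v x ∂μ := by ring

/-- Strong type `(q, q)` of `ratioMaximal U v` with respect to `v dμ`, with a constant independent
of `v`. -/
theorem lintegral_ratioMaximal_rpow_le {μ : Measure X} [SFinite μ] {U : X ≃ᵐ X}
    (hU : MeasurePreserving U μ μ) {q : ℝ} (hq : 1 < q) {v g : X → ℝ≥0∞} (hv : Measurable v)
    (hg : Measurable g) :
    ∫⁻ x, ratioMaximal U v g x ^ q * v x ∂μ ≤ strongConst q * ∫⁻ x, g x ^ q * v x ∂μ := by
  refine lintegral_rpow_mul_le hq (measurable_ratioMaximal U hv hg) hg hv fun c => ?_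
  rcases eq_or_ne c ⊤ with rfl | hc
  · simp
  set A : Set X := {x | c / 2 < g x} with hA
  have hAm : MeasurableSet A := measurableSet_lt measurable_const hg
  -- Only the part of `g` above `c / 2` matters for the level `c`.
  have hle : ∀ x, ratioMaximal U v g x ≤ ratioMaximal U v (A.indicator g) x + c / 2 := by
    intro x
    refine iSup_le fun a => iSup_le fun b => iSup_le fun ha => iSup_le fun hb => ?_
    calc orbitSum U (fun y => g y * v y) a b x / orbitSum U v a b x
        ≤ (orbitSum U (fun y => A.indicator g y * v y) a b x + c / 2 * orbitSum U v a b x) /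
            orbitSum U v a b x := by
          gcongr
          unfold orbitSum
          rw [Finset.mul_sum, ← Finset.sum_add_distrib]
          refine Finset.sum_le_sum fun k _ => ?_
          rw [← add_mul]
          refine mul_le_mul' ?_ le_rfl
          by_cases hk : (((U.toEquiv : Equiv.Perm X) ^ k) x) ∈ A
          · simp [hk]
          · simp only [hA, Set.mem_ofPred_eq, not_lt] at hk
            exact hk.trans le_add_self
      _ ≤ _ := by
          rw [ENNReal.add_div]
          refine add_le_add ?_ ?_
          · simpa using orbitSum_div_le_ratioMaximal U v (A.indicator g) ha hb x
          · exact ENNReal.div_le_of_le_mul le_rfl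
  have hsub : {x | c < ratioMaximal U v g x} ⊆
      {x | c / 2 < ratioMaximal U v (A.indicator g) x} := by
    intro x (hx : c < _)
    by_contra hn
    simp only [Set.mem_ofPred_eq, not_lt] at hn
    refine absurd hx (not_lt.2 ((hle x).trans ((add_le_add_left hn _).trans ?_)))
    rw [ENNReal.add_halves]
  calc c * ∫⁻ x in {x | c < ratioMaximal U v g x}, v x ∂μ
      ≤ c * ∫⁻ x in {x | c / 2 < ratioMaximal U v (A.indicator g) x}, v x ∂μ := by
        gcongr
    _ = 2 * (c / 2 * ∫⁻ x in {x | c / 2 < ratioMaximal U v (A.indicator g) x}, v x ∂μ) := by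
        rw [← mul_assoc, ENNReal.mul_div_cancel two_ne_zero ENNReal.ofNat_ne_top]
    _ ≤ 2 * (4 * ∫⁻ x, A.indicator g x * v x ∂μ) := by
        gcongr 2 * ?_
        exact mul_setLIntegral_ratioMaximal_le hU hv (hg.indicator hAm) _
    _ = 8 * ∫⁻ x in A, g x * v x ∂μ := by
        rw [← lintegral_indicator hAm, ← mul_assoc]
        congr 1
        · norm_num
        · refine lintegral_congr fun x => ?_
          by_cases hx : x ∈ A <;> simp [hx]

end Ratio

/-! ### Muckenhoupt weights -/

section Weights

variable {X : Type*} [MeasurableSpace X]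

theorem maximalErgodic_eq_iSup_orbitSum {ε : Type*} [ENorm ε] (U : X ≃ᵐ X) (f : X → ε) (x : X) :
    maximalErgodic U f x = ⨆ (J : ℕ) (_ : 1 ≤ J),
      orbitSum U (fun y => ‖f y‖ₑ) (-(J : ℤ)) J x / (2 * (J : ℝ≥0∞) + 1) := by
  unfold maximalErgodic orbitSum
  refine iSup_congr fun J => iSup_congr fun _ => congrArg (· / _) ?_
  refine Finset.sum_nbij' (- ·) (- ·) ?_ ?_ ?_ ?_ ?_ <;> intro k hk
  · simp only [Finset.mem_Icc] at hk ⊢; omega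
  · simp only [Finset.mem_Icc] at hk ⊢; omega
  · simp
  · simp
  · simp

theorem measurable_maximalErgodic (U : X ≃ᵐ X) {F : X → ℝ≥0∞} (hF : Measurable F) :
    Measurable (maximalErgodic U F) := by
  rw [funext (maximalErgodic_eq_iSup_orbitSum U F)]
  exact Measurable.iSup fun J => Measurable.iSup fun _ =>
    (measurable_orbitSum U hF _ _).div measurable_const

theorem self_le_orbitSum (U : X ≃ᵐ X) (φ : X → ℝ≥0∞) {a b k : ℤ} (ha : a ≤ k) (hb : k ≤ b)
    (x : X) : φ (((U.toEquiv : Equiv.Perm X) ^ k) x) ≤ orbitSum U φ a b x :=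
  Finset.single_le_sum (f := fun k : ℤ => φ (((U.toEquiv : Equiv.Perm X) ^ k) x))
    (fun _ _ => zero_le) (Finset.mem_Icc.2 ⟨ha, hb⟩)

theorem orbitSum_ne_top (U : X ≃ᵐ X) {φ : X → ℝ≥0∞} {x : X}
    (h : ∀ k : ℤ, φ (((U.toEquiv : Equiv.Perm X) ^ k) x) ≠ ⊤) (a b : ℤ) :
    orbitSum U φ a b x ≠ ⊤ :=
  ENNReal.sum_ne_top.2 fun k _ => h k

/-- Lerner's pointwise bound of the averages by a composition of two maximal operators of weights,
`w` and its dual weight `σ = w^(-1/(p-1))`. The function `f/σ` is encoded as `F * W^(1/(p-1))`. -/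
theorem average_rpow_le_ratioMaximal (U : X ≃ᵐ X) {p : ℝ} (hp : 1 < p) {K : ℝ≥0∞} (hK : K ≠ ⊤)
    {W : X → ℝ≥0∞} (F : X → ℝ≥0∞) {x : X} (hx : W x ≠ 0)
    (hfin : ∀ k : ℤ, W (((U.toEquiv : Equiv.Perm X) ^ k) x) ≠ ⊤) {J : ℕ}
    (hA : ergodicAverage U W J x *
      ergodicAverage U (fun y => W y ^ (-1 / (p - 1))) J x ^ (p - 1) ≤ K) :
    (orbitSum U F (-(J : ℤ)) J x / (2 * (J : ℝ≥0∞) + 1)) ^ (p - 1) ≤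
      K * ratioMaximal U W (fun y =>
        ratioMaximal U (fun z => W z ^ (-1 / (p - 1))) (fun z => F z * W z ^ (1 / (p - 1))) y
          ^ (p - 1) * (W y)⁻¹) x := by
  have hp1 : 0 < p - 1 := by linarith
  set σ : X → ℝ≥0∞ := fun z => W z ^ (-1 / (p - 1)) with hσ
  set g : X → ℝ≥0∞ := fun z => F z * W z ^ (1 / (p - 1)) with hg
  set h : X → ℝ≥0∞ := fun y => ratioMaximal U σ g y ^ (p - 1) * (W y)⁻¹ with hh
  set n : ℝ≥0∞ := 2 * (J : ℝ≥0∞) + 1 with hn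
  have hn0 : n ≠ 0 := by simp [hn]
  have hnt : n ≠ ⊤ := by simp [hn, ENNReal.mul_eq_top]
  set ws := orbitSum U W (-(J : ℤ)) J x with hws
  set s := orbitSum U σ (-(J : ℤ)) J x with hs
  have hws0 : ws ≠ 0 := by
    have := self_le_orbitSum U W (a := -(J : ℤ)) (b := J) (k := 0) (by omega) (by omega) x
    rw [zpow_zero, Equiv.Perm.one_apply] at this
    exact (lt_of_lt_of_le (pos_iff_ne_zero.2 hx) this).ne'
  have hwst : ws ≠ ⊤ := orbitSum_ne_top U hfin _ _
  have hs0 : s ≠ 0 := by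
    have := self_le_orbitSum U σ (a := -(J : ℤ)) (b := J) (k := 0) (by omega) (by omega) x
    refine (lt_of_lt_of_le (pos_iff_ne_zero.2 fun h0 => ?_) this).ne'
    simp only [hσ, ENNReal.rpow_eq_zero_iff] at h0
    rcases h0 with ⟨_, h0⟩ | ⟨h0, _⟩
    · rw [neg_div] at h0
      linarith [one_div_pos.2 hp1]
    · exact hfin 0 h0
  replace hA : ws / n * (s / n) ^ (p - 1) ≤ K := hA
  have hst : s ≠ ⊤ := by
    intro hst
    rw [hst, ENNReal.top_div_of_ne_top hnt, ENNReal.top_rpow_of_pos hp1, ENNReal.mul_top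
      (ENNReal.div_ne_zero.2 ⟨hws0, hnt⟩)] at hA
    exact hK (top_le_iff.1 hA)
  -- Finiteness of the dual average forces the weight to be positive on the whole window.
  have hW0 : ∀ k ∈ Finset.Icc (-(J : ℤ)) J, W (((U.toEquiv : Equiv.Perm X) ^ k) x) ≠ 0 := by
    intro k hk h0
    rw [Finset.mem_Icc] at hk
    refine hst (top_le_iff.1 ?_)
    refine le_trans (le_of_eq ?_) (self_le_orbitSum U σ hk.1 hk.2 x)
    simp only [hσ, h0]
    rw [ENNReal.zero_rpow_of_neg]
    rw [neg_div]
    linarith [one_div_pos.2 hp1]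
  set A := orbitSum U F (-(J : ℤ)) J x
  have hAg : A = orbitSum U (fun y => g y * σ y) (-(J : ℤ)) J x := by
    refine Finset.sum_congr rfl fun k hk => ?_
    simp only [hg, hσ]
    rw [mul_assoc, ← ENNReal.rpow_add _ _ (hW0 k hk) (hfin k)]
    simp [neg_div]
  have hsum : n * (A / s) ^ (p - 1) ≤ orbitSum U (fun y => h y * W y) (-(J : ℤ)) J x := by
    have : n * (A / s) ^ (p - 1) = ∑ k ∈ Finset.Icc (-(J : ℤ)) J, (A / s) ^ (p - 1) := by
      rw [Finset.sum_const, Int.card_Icc, nsmul_eq_mul,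
        show ((J : ℤ) + 1 - -(J : ℤ)).toNat = 2 * J + 1 by omega]
      push_cast
      rfl
    rw [this]
    refine Finset.sum_le_sum fun k hk => ?_
    simp only [hh]
    rw [mul_assoc, ENNReal.inv_mul_cancel (hW0 k hk) (hfin k), mul_one, hAg]
    rw [Finset.mem_Icc] at hk
    gcongr
    exact orbitSum_div_le_ratioMaximal U σ g hk.1 hk.2 x
  have hR : orbitSum U (fun y => h y * W y) (-(J : ℤ)) J x / ws ≤ ratioMaximal U W h x := by
    have := orbitSum_div_le_ratioMaximal U W h (a := -(J : ℤ)) (b := J) (m := 0)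
      (by omega) (by omega) x
    rwa [zpow_zero, Equiv.Perm.one_apply] at this
  calc (A / n) ^ (p - 1) = (s / n) ^ (p - 1) * (A / s) ^ (p - 1) := by
        rw [← ENNReal.mul_rpow_of_nonneg _ _ hp1.le]
        congr 1
        rw [mul_comm, div_eq_mul_inv A s, mul_assoc, ← mul_div_assoc,
          ENNReal.inv_mul_cancel hs0 hst, one_div, div_eq_mul_inv]
    _ = (ws / n * (n / ws)) * ((s / n) ^ (p - 1) * (A / s) ^ (p - 1)) := by
        rw [← ENNReal.inv_div (Or.inl hnt) (Or.inl hn0), ENNReal.mul_inv_cancel, one_mul]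
        · exact ENNReal.div_ne_zero.2 ⟨hws0, hnt⟩
        · exact ENNReal.div_ne_top hwst hn0
    _ = (ws / n * (s / n) ^ (p - 1)) * (n * (A / s) ^ (p - 1) / ws) := by
        simp only [div_eq_mul_inv]
        ring
    _ ≤ K * ratioMaximal U W h x := by
        refine mul_le_mul' hA (le_trans ?_ hR)
        gcongr

theorem lintegral_maximalErgodic_rpow_le {μ : Measure X} [SFinite μ] {U : X ≃ᵐ X}
    (hU : MeasurePreserving U μ μ) {p : ℝ} (hp : 1 < p) {K : ℝ≥0∞} (hK : K ≠ ⊤)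
    {W F : X → ℝ≥0∞} (hW : Measurable W) (hF : Measurable F)
    (hfin : ∀ᵐ x ∂μ, ∀ k : ℤ, W (((U.toEquiv : Equiv.Perm X) ^ k) x) ≠ ⊤)
    (hA : ∀ᵐ x ∂μ, ∀ N : ℕ, 1 ≤ N → ergodicAverage U W N x *
      ergodicAverage U (fun y => W y ^ (-1 / (p - 1))) N x ^ (p - 1) ≤ K) :
    ∫⁻ x, maximalErgodic U F x ^ p * W x ∂μ ≤
      K ^ (p / (p - 1)) * (strongConst (p / (p - 1)) * strongConst p) *
        ∫⁻ x, F x ^ p * W x ∂μ := by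
  have hp0 : 0 < p := by linarith
  have hp1 : 0 < p - 1 := by linarith
  have hq : 1 < p / (p - 1) := by rw [lt_div_iff₀ hp1]; linarith
  have hq0 : 0 < p / (p - 1) := by linarith
  set σ : X → ℝ≥0∞ := fun z => W z ^ (-1 / (p - 1)) with hσ
  set g : X → ℝ≥0∞ := fun z => F z * W z ^ (1 / (p - 1)) with hg
  set h : X → ℝ≥0∞ := fun y => ratioMaximal U σ g y ^ (p - 1) * (W y)⁻¹ with hh
  have hσm : Measurable σ := hW.pow_const _
  have hgm : Measurable g := hF.mul (hW.pow_const _)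
  have hMm := measurable_ratioMaximal U hσm hgm
  have hhm : Measurable h := (hMm.pow_const _).mul hW.inv
  -- `p * (1/(p-1)) = p'`, so the `p`-th power of the maximal function is at most
  -- `(K * M_w h)^p'`.
  have h1 : ∫⁻ x, maximalErgodic U F x ^ p * W x ∂μ ≤
      K ^ (p / (p - 1)) * ∫⁻ x, ratioMaximal U W h x ^ (p / (p - 1)) * W x ∂μ := by
    rw [← lintegral_const_mul' _ _ (ENNReal.rpow_ne_top_of_nonneg hq0.le hK)]
    refine lintegral_mono_ae ?_
    filter_upwards [hfin, hA] with x hxf hxA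
    rcases eq_or_ne (W x) 0 with h0 | h0
    · simp [h0]
    rw [← mul_assoc, ← ENNReal.mul_rpow_of_nonneg _ _ hq0.le]
    gcongr
    have hM : maximalErgodic U F x ≤ (K * ratioMaximal U W h x) ^ (1 / (p - 1)) := by
      rw [maximalErgodic_eq_iSup_orbitSum]
      refine iSup₂_le fun J hJ => ?_
      rw [one_div, ENNReal.le_rpow_inv_iff hp1]
      exact average_rpow_le_ratioMaximal U hp hK F h0 hxf (hxA J hJ)
    calc maximalErgodic U F x ^ p ≤ ((K * ratioMaximal U W h x) ^ (1 / (p - 1))) ^ p := by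
          gcongr
      _ = _ := by rw [← ENNReal.rpow_mul, one_div_mul_eq_div]
  -- `(p - 1) * p' = p` and `w^(1-p') = σ`.
  have h2 : ∫⁻ x, h x ^ (p / (p - 1)) * W x ∂μ ≤ ∫⁻ x, ratioMaximal U σ g x ^ p * σ x ∂μ := by
    refine lintegral_mono_ae ?_
    filter_upwards [hfin] with x hxf
    rcases eq_or_ne (W x) 0 with h0 | h0
    · simp [h0]
    simp only [hh, hσ]
    rw [ENNReal.mul_rpow_of_nonneg _ _ hq0.le, ← ENNReal.rpow_mul, mul_div_cancel₀ _ hp1.ne',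
      mul_assoc]
    refine le_of_eq (congrArg _ ?_)
    rw [← ENNReal.rpow_neg_one, ← ENNReal.rpow_mul]
    nth_rw 2 [← ENNReal.rpow_one (W x)]
    rw [← ENNReal.rpow_add _ _ h0 (hxf 0)]
    congr 1
    field_simp
    ring
  -- `(f/σ)^p σ = f^p w`, since `σ^(1-p) = w`.
  have h3 : ∫⁻ x, g x ^ p * σ x ∂μ ≤ ∫⁻ x, F x ^ p * W x ∂μ := by
    refine lintegral_mono_ae ?_
    filter_upwards [hfin] with x hxf
    simp only [hg, hσ]
    rcases eq_or_ne (W x) 0 with h0 | h0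
    · simp [h0, hp1, hp0]
    rw [ENNReal.mul_rpow_of_nonneg _ _ hp0.le, mul_assoc, ← ENNReal.rpow_mul,
      ← ENNReal.rpow_add _ _ h0 (hxf 0)]
    refine le_of_eq (congrArg _ ?_)
    nth_rw 2 [← ENNReal.rpow_one (W x)]
    congr 1
    field_simp
    ring
  rw [mul_assoc]
  refine h1.trans (mul_le_mul' le_rfl ?_)
  refine (lintegral_ratioMaximal_rpow_le hU hq hW hhm).trans ?_
  rw [mul_assoc]
  refine mul_le_mul' le_rfl (h2.trans ?_)
  exact (lintegral_ratioMaximal_rpow_le hU hp hσm hgm).trans (mul_le_mul' le_rfl h3)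

theorem maximalErgodic_le_ratioMaximal (U : X ≃ᵐ X) {K : ℝ≥0∞} {W : X → ℝ≥0∞} (F : X → ℝ≥0∞)
    {x : X} (hx : W x ≠ 0) (hfin : ∀ k : ℤ, W (((U.toEquiv : Equiv.Perm X) ^ k) x) ≠ ⊤)
    (hA : ∀ N : ℕ, 1 ≤ N → ∀ m : ℤ, -(N : ℤ) ≤ m → m ≤ (N : ℤ) →
      ergodicAverage U W N x ≤ K * W (((U.toEquiv : Equiv.Perm X) ^ m) x)) :
    maximalErgodic U F x ≤ K * ratioMaximal U W F x := by
  rw [maximalErgodic_eq_iSup_orbitSum]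
  refine iSup₂_le fun J hJ => ?_
  set n : ℝ≥0∞ := 2 * (J : ℝ≥0∞) + 1 with hn
  set ws := orbitSum U W (-(J : ℤ)) J x with hws
  have hws0 : ws ≠ 0 := by
    have := self_le_orbitSum U W (a := -(J : ℤ)) (b := J) (k := 0) (by omega) (by omega) x
    rw [zpow_zero, Equiv.Perm.one_apply] at this
    exact (lt_of_lt_of_le (pos_iff_ne_zero.2 hx) this).ne'
  have hwst : ws ≠ ⊤ := orbitSum_ne_top U hfin _ _
  have hsum : orbitSum U F (-(J : ℤ)) J x * (ws / n) ≤
      K * orbitSum U (fun y => F y * W y) (-(J : ℤ)) J x := by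
    unfold orbitSum
    rw [Finset.sum_mul, Finset.mul_sum]
    refine Finset.sum_le_sum fun k hk => ?_
    rw [Finset.mem_Icc] at hk
    rw [mul_left_comm]
    gcongr
    exact hA J hJ k hk.1 hk.2
  have hR := orbitSum_div_le_ratioMaximal U W F (a := -(J : ℤ)) (b := J) (m := 0)
      (by omega) (by omega) x
  rw [zpow_zero, Equiv.Perm.one_apply] at hR
  refine le_trans ?_ (mul_le_mul' le_rfl hR)
  rw [← mul_div_assoc, ENNReal.le_div_iff_mul_le (Or.inl hws0) (Or.inl hwst)]
  refine le_of_eq_of_le ?_ hsum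
  simp only [enorm_eq_self, div_eq_mul_inv, hws]
  ring

/-- The factor `K + 1` in place of `K` avoids a division by zero when `K = 0`. -/
theorem setLIntegral_maximalErgodic_le {μ : Measure X} {U : X ≃ᵐ X}
    (hU : MeasurePreserving U μ μ) {K : ℝ≥0∞} (hK : K ≠ ⊤)
    {W F : X → ℝ≥0∞} (hW : Measurable W) (hF : Measurable F)
    (hfin : ∀ᵐ x ∂μ, ∀ k : ℤ, W (((U.toEquiv : Equiv.Perm X) ^ k) x) ≠ ⊤)
    (hA : ∀ᵐ x ∂μ, ∀ N : ℕ, 1 ≤ N → ∀ m : ℤ, -(N : ℤ) ≤ m → m ≤ (N : ℤ) →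
      ergodicAverage U W N x ≤ K * W (((U.toEquiv : Equiv.Perm X) ^ m) x))
    {c : ℝ≥0∞} (hc0 : c ≠ 0) (hct : c ≠ ⊤) :
    ∫⁻ x in {x | c < maximalErgodic U F x}, W x ∂μ ≤
      4 * (K + 1) / c * ∫⁻ x, F x * W x ∂μ := by
  have hK1 : K + 1 ≠ ⊤ := by simp [hK]
  have h1 : ∫⁻ x in {x | c < maximalErgodic U F x}, W x ∂μ ≤
      ∫⁻ x in {x | c / (K + 1) < ratioMaximal U W F x}, W x ∂μ := by
    rw [← lintegral_indicator (measurableSet_lt measurable_const (measurable_maximalErgodic U hF)),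
      ← lintegral_indicator
        (measurableSet_lt measurable_const (measurable_ratioMaximal U hW hF))]
    refine lintegral_mono_ae ?_
    filter_upwards [hfin, hA] with x hxf hxA
    rcases eq_or_ne (W x) 0 with h0 | h0
    · simp [Set.indicator_apply, h0]
    rw [Set.indicator_apply]
    split_ifs with hx
    · rw [Set.indicator_of_mem]
      have hlt : c < K * ratioMaximal U W F x :=
        lt_of_lt_of_le hx (maximalErgodic_le_ratioMaximal U F h0 hxf hxA)
      refine ENNReal.div_lt_of_lt_mul' (hlt.trans_le ?_)
      gcongr
      exact le_self_add
    · exact zero_le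
  refine h1.trans ?_
  have h2 := mul_setLIntegral_ratioMaximal_le hU hW hF (c / (K + 1))
  rw [mul_comm, ← ENNReal.le_div_iff_mul_le (Or.inl (ENNReal.div_ne_zero.2 ⟨hc0, hK1⟩))
    (Or.inl (ENNReal.div_ne_top hct (by simp)))] at h2
  refine h2.trans (le_of_eq ?_)
  rw [div_eq_mul_inv, ENNReal.inv_div (Or.inl hK1) (Or.inl (by simp))]
  simp only [div_eq_mul_inv]
  ring

/-- An almost everywhere measurable function has a measurable representative that agrees with it
along the whole orbit of almost every point. -/
theorem exists_measurable_ae_orbit_eq {μ : Measure X} {U : X ≃ᵐ X} (hU : MeasurePreserving U μ μ)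
    {φ : X → ℝ≥0∞} (hφ : AEMeasurable φ μ) : ∃ ψ : X → ℝ≥0∞, Measurable ψ ∧
      ∀ᵐ x ∂μ, ∀ k : ℤ, ψ (((U.toEquiv : Equiv.Perm X) ^ k) x) =
        φ (((U.toEquiv : Equiv.Perm X) ^ k) x) :=
  ⟨hφ.mk φ, hφ.measurable_mk, ae_all_iff.2 fun k =>
    (measurePreserving_zpow hU k).quasiMeasurePreserving.ae hφ.ae_eq_mk.symm⟩

theorem maximalErgodic_congr {ε : Type*} [ENorm ε] {U : X ≃ᵐ X} {F : X → ℝ≥0∞} {f : X → ε} {x : X}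
    (h : ∀ k : ℤ, F (((U.toEquiv : Equiv.Perm X) ^ k) x) =
      ‖f (((U.toEquiv : Equiv.Perm X) ^ k) x)‖ₑ) :
    maximalErgodic U F x = maximalErgodic U f x := by
  simp only [maximalErgodic, h, enorm_eq_self]

end Weights

end ErgodicWeights

open ErgodicWeights in
theorem mainTheorem1 :
    (∀ p : ℝ, 1 < p → ∀ K : ℝ≥0, ∃ C : ℝ≥0,
      ∀ (X : Type*) [MeasurableSpace X] (μ : Measure X) [IsProbabilityMeasure μ] (U : X ≃ᵐ X),
        MeasurePreserving U μ μ →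
        ∀ w : X → ℝ, ErgodicWeights.IsErgodicApWeight U μ p w K →
        ∀ (𝕜 : Type*) [RCLike 𝕜] (f : X → 𝕜), ErgodicWeights.MemWeightedLp μ p w f →
          ErgodicWeights.MemWeightedLp μ p w (ErgodicWeights.maximalErgodic U f) ∧
          ErgodicWeights.weightedLpNorm μ p w (ErgodicWeights.maximalErgodic U f) ≤
            (C : ℝ≥0∞) * ErgodicWeights.weightedLpNorm μ p w f) ∧
    (∀ K : ℝ≥0, ∃ C : ℝ≥0,
      ∀ (X : Type*) [MeasurableSpace X] (μ : Measure X) [IsProbabilityMeasure μ] (U : X ≃ᵐ X),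
        MeasurePreserving U μ μ →
        ∀ w : X → ℝ, ErgodicWeights.IsErgodicA1Weight U μ w K →
        ∀ (𝕜 : Type*) [RCLike 𝕜] (f : X → 𝕜), ErgodicWeights.MemWeightedLp μ 1 w f →
          AEMeasurable (ErgodicWeights.maximalErgodic U f) μ ∧
          ∀ lam : ℝ, 0 < lam →
            ∫⁻ x in {x | ENNReal.ofReal lam < ErgodicWeights.maximalErgodic U f x},
                ENNReal.ofReal (w x) ∂μ ≤
              (C : ℝ≥0∞) / ENNReal.ofReal lam *
                ∫⁻ x, ‖f x‖ₑ * ENNReal.ofReal (w x) ∂μ) := by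
  refine ⟨fun p hp K => ?_, fun K => ?_⟩
  · have hp0 : 0 < p := by linarith
    have hp1 : 0 < p - 1 := by linarith
    have hD : ((K : ℝ≥0∞) ^ (p / (p - 1)) * (strongConst (p / (p - 1)) * strongConst p)) ≠ ⊤ :=
      ENNReal.mul_ne_top (ENNReal.rpow_ne_top_of_nonneg (by positivity) ENNReal.coe_ne_top)
        (ENNReal.mul_ne_top (strongConst_ne_top (by rw [lt_div_iff₀ hp1]; linarith))
          (strongConst_ne_top hp))
    set D := (K : ℝ≥0∞) ^ (p / (p - 1)) * (strongConst (p / (p - 1)) * strongConst p)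
    refine ⟨(D ^ (1 / p)).toNNReal, fun X _ μ _ U hU w hw 𝕜 _ f hf => ?_⟩
    obtain ⟨W, hWm, hW⟩ :=
      exists_measurable_ae_orbit_eq hU hw.integrable.aestronglyMeasurable.aemeasurable.ennreal_ofReal
    obtain ⟨F, hFm, hF⟩ := exists_measurable_ae_orbit_eq hU hf.1.enorm
    have hmax : maximalErgodic U F =ᵐ[μ] maximalErgodic U f := hF.mono fun x => maximalErgodic_congr
    have hmain : ∫⁻ x, ‖maximalErgodic U f x‖ₑ ^ p * ENNReal.ofReal (w x) ∂μ ≤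
        D * ∫⁻ x, ‖f x‖ₑ ^ p * ENNReal.ofReal (w x) ∂μ := by
      have h := lintegral_maximalErgodic_rpow_le hU hp (K := K) ENNReal.coe_ne_top hWm hFm
        (hW.mono fun x hx k => by rw [hx k]; exact ENNReal.ofReal_ne_top) (by
          filter_upwards [hW, ENNReal.ae_le_essSup (μ := μ) (fun x => ⨆ (N : ℕ) (_ : 1 ≤ N),
            ergodicAverage U (fun y => ENNReal.ofReal (w y)) N x *
            ergodicAverage U (fun y => ENNReal.ofReal (w y) ^ (-1 / (p - 1))) N x ^ (p - 1))]
            with x hx hsup N hN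
          simp only [ergodicAverage, hx]
          exact (le_iSup₂ (f := fun (N : ℕ) (_ : 1 ≤ N) =>
            ergodicAverage U (fun y => ENNReal.ofReal (w y)) N x *
            ergodicAverage U (fun y => ENNReal.ofReal (w y) ^ (-1 / (p - 1))) N x ^ (p - 1))
            N hN).trans (hsup.trans hw.essSup_le))
      refine le_of_eq_of_le (lintegral_congr_ae ?_) (h.trans_eq (congrArg _ (lintegral_congr_ae ?_)))
      · filter_upwards [hmax, hW] with x hx hx'
        exact congrArg₂ (fun s t => s ^ p * t) hx.symm (hx' 0).symm
      · filter_upwards [hF, hW] with x hx hx'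
        exact congrArg₂ (fun s t => s ^ p * t) (hx 0) (hx' 0)
    refine ⟨⟨(measurable_maximalErgodic U hFm).aemeasurable.congr hmax,
      hmain.trans_lt (ENNReal.mul_lt_top hD.lt_top hf.2)⟩, ?_⟩
    rw [ENNReal.coe_toNNReal (ENNReal.rpow_ne_top_of_nonneg (by positivity) hD), weightedLpNorm,
      weightedLpNorm, ← ENNReal.mul_rpow_of_nonneg _ _ (by positivity)]
    gcongr
  · refine ⟨4 * (K + 1), fun X _ μ _ U hU w hw 𝕜 _ f hf => ?_⟩
    obtain ⟨W, hWm, hW⟩ :=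
      exists_measurable_ae_orbit_eq hU hw.integrable.aestronglyMeasurable.aemeasurable.ennreal_ofReal
    obtain ⟨F, hFm, hF⟩ := exists_measurable_ae_orbit_eq hU hf.1.enorm
    have hmax : maximalErgodic U F =ᵐ[μ] maximalErgodic U f := hF.mono fun x => maximalErgodic_congr
    refine ⟨(measurable_maximalErgodic U hFm).aemeasurable.congr hmax, fun lam hlam => ?_⟩
    have h := setLIntegral_maximalErgodic_le hU (K := K) ENNReal.coe_ne_top hWm hFm
      (hW.mono fun x hx k => by rw [hx k]; exact ENNReal.ofReal_ne_top) (by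
        filter_upwards [hW, hw.average_le] with x hx havg N hN m hm hm'
        rw [hx m]
        simp only [ergodicAverage, hx]
        exact havg N hN m hm hm')
      (c := ENNReal.ofReal lam) (by simpa using hlam) ENNReal.ofReal_ne_top
    have hset : {x | ENNReal.ofReal lam < maximalErgodic U F x} =ᵐ[μ]
        {x | ENNReal.ofReal lam < maximalErgodic U f x} := by
      filter_upwards [hmax] with x hx
      exact congrArg (ENNReal.ofReal lam < ·) hx
    have hW0 : W =ᵐ[μ] fun x => ENNReal.ofReal (w x) := hW.mono fun x hx => hx 0
    rw [← setLIntegral_congr hset, ← lintegral_congr_ae (ae_restrict_of_ae hW0)]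
    push_cast
    refine h.trans_eq (congrArg _ (lintegral_congr_ae ?_))
    filter_upwards [hF, hW] with x hx hx'
    exact congrArg₂ (fun s t => s * t) (hx 0) (hx' 0)
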